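/- Let $P_n$ denote the $n$-th Legendre polynomial, $P_n(x)=\frac{1}{2^n n!}\frac{d^n}{dx^n}(x^2-1)^n$. For an integer $N\ge 3$ the $N$-point Lobatto quadrature of $f:[-1,1]\to\mathbb{R}$ is $$\mathrm{Lob}_N(f)=\frac{2}{N(N-1)}\bigl(f(-1)+f(1)\bigr)+\sum_{i=2}^{N-1}\frac{2}{N(N-1)\,P_{N-1}(x_i)^2}\,f(x_i),$$ where $x_2,\dots,x_{N-1}$ are the roots of $P_{N-1}'$ (these are real, distinct and lie in $(-1,1)$). For $n\ge 1$ put $$\alpha_{2n}=\frac{4^{n+1}(n!)^4}{(2n+1)\,[(2n)!]^3},\qquad \alpha_{2n+1}=\frac{4^{n+1}(n+1)(n!)^4}{[(2n+1)!]^3}.$$ **Proposition (Lobatto error bound).** Let $k,N$ be integers with $k\ge 2$ and $N>\lfloor k/2\rfloor+1$ (hence $N\ge 3$). Then for every $f\in C^k([-1,1])$, $$\Bigl|\int_{-1}^1 f(x)\,dx-\mathrm{Lob}_N(f)\Bigr|\le\alpha_k\,\|f^{(k)}\|,$$ where $\|g\|=\sup\{|g(x)|:x\in[-1,1]\}$ for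 continuous $g:[-1,1]\to\mathbb{R}$ and derivatives at the end points are one-sided. -/

import Mathlib

open Polynomial

noncomputable section

/-- The Legendre polynomial `P_n`, given by Rodrigues' formula
`P_n = (1 / (2 ^ n n!)) (d/dx) ^ n (x ^ 2 - 1) ^ n`. -/
def legendreP (n : ℕ) : ℝ[X] :=
  C (1 / (2 ^ n * (n.factorial : ℝ))) * derivative^[n] ((X ^ 2 - 1) ^ n)

/-- The interior weight `2 / (n (n - 1) P_{n-1}(x) ^ 2)` of the `n`-point Lobatto quadrature. -/
def lobattoWeight (n : ℕ) (x : ℝ) : ℝ :=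
  2 / ((n : ℝ) * ((n : ℝ) - 1) * (legendreP (n - 1)).eval x ^ 2)

/-- The `n`-point Lobatto quadrature (meaningful for `n ≥ 2`): the end points carry the weight
`2 / (n (n - 1))`, and the interior nodes are the roots of the derivative of `P_{n-1}`. -/
def lobatto (n : ℕ) (f : ℝ → ℝ) : ℝ :=
  2 / ((n : ℝ) * ((n : ℝ) - 1)) * f (-1) + 2 / ((n : ℝ) * ((n : ℝ) - 1)) * f 1
    + ∑ x ∈ (derivative (legendreP (n - 1))).roots.toFinset, lobattoWeight n x * f x

/-- The constant with `α_{2n} = 4^(n+1) (n!)^4 / ((2n+1) ((2n)!)^3)` and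
`α_{2n+1} = 4^(n+1) (n+1) (n!)^4 / ((2n+1)!)^3`; in both cases `n = k / 2` rounded down. -/
def alphaConst (k : ℕ) : ℝ :=
  if Even k then
    4 ^ (k / 2 + 1) * ((k / 2).factorial : ℝ) ^ 4 / (((k : ℝ) + 1) * (k.factorial : ℝ) ^ 3)
  else
    4 ^ (k / 2 + 1) * (((k / 2 : ℕ) : ℝ) + 1) * ((k / 2).factorial : ℝ) ^ 4
      / (k.factorial : ℝ) ^ 3

/-- The supremum norm over `[-1, 1]`; it is used for functions continuous on `[-1, 1]`. -/
def supNormIcc (g : ℝ → ℝ) : ℝ :=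
  sSup ((fun x => |g x|) '' Set.Icc (-1 : ℝ) 1)

end

/-! Write $k=2n+b$ with $b\in\{0,1\}$ and $N=m+1$. Lobatto quadrature has positive weights and is
exact up to degree $2m-1\ge k$. If $p$ interpolates $f$ at $k$ points of $[-1,1]$ with node
polynomial $W$, then $|f-p|\le\|f^{(k)}\|\,|W|/k!$. Since $p$ is integrated exactly, the error is at
most $\|f^{(k)}\|/k!$ times the integral of $|W|$ plus its quadrature sum. If $W\ge0$ on $[-1,1]$,
exactness at $W$ itself makes both terms $\int W$, so the bound is $2\|f^{(k)}\|/k!\int W$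
(`abs_integral_sub_sum_le_of_splits`).

Taking $W=(1+x)^b\omega^2$, with $\omega$ the monic Gauss or Gauss-Radau orthogonal polynomial of
degree $n$, gives $2\int W/k!=\alpha_k$ (`exists_extremal_polynomial`, `alphaConst_two_mul_add`).
The exactness (`integral_eq_sum_lobattoNodes`) and the explicit weights
(`integralIcc_basis_lobattoNodes`) come from the Legendre equation and integration by parts. -/

/-! ### Generalized Rolle theorem and the Lagrange interpolation error. -/

theorem exists_iteratedDerivWithin_eq_zero {a b : ℝ} (k : ℕ) :
    ∀ (g : ℝ → ℝ), ContDiffOn ℝ k g (Set.Icc a b) →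
      ∀ y : Fin (k + 1) → ℝ, StrictMono y → (∀ i, y i ∈ Set.Icc a b) → (∀ i, g (y i) = 0) →
        ∃ ξ ∈ Set.Icc a b, iteratedDerivWithin k g (Set.Icc a b) ξ = 0 := by
  induction k with
  | zero =>
    intro g _ y _ hm h0
    exact ⟨y 0, hm 0, by simpa using h0 0⟩
  | succ k ih =>
    intro g hg y hy hm h0
    have hab : a < b := ((hm 0).1.trans_lt (hy (Fin.lt_def.2 (by simp : (0 : Fin (k + 2)).1 <
      (Fin.last (k + 1)).1)))).trans_le (hm _).2
    have hu : UniqueDiffOn ℝ (Set.Icc a b) := uniqueDiffOn_Icc hab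
    have hsub : ∀ i : Fin (k + 1), Set.Icc (y i.castSucc) (y i.succ) ⊆ Set.Icc a b := fun i =>
      Set.Icc_subset_Icc (hm _).1 (hm _).2
    -- The Rolle zeros are interior to $[a,b]$, where `deriv` and `derivWithin` agree, and they
    -- interlace the `y i`, so they are again strictly increasing.
    have hz : ∀ i : Fin (k + 1), ∃ z ∈ Set.Ioo (y i.castSucc) (y i.succ), deriv g z = 0 := fun i =>
      exists_deriv_eq_zero (hy (Fin.castSucc_lt_succ)) (hg.continuousOn.mono (hsub i))
        (by rw [h0, h0])
    choose z hzm hz0 using hz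
    have hzm' : ∀ i, z i ∈ Set.Ioo a b := fun i =>
      ⟨(hm _).1.trans_lt (hzm i).1, (hzm i).2.trans_le (hm _).2⟩
    obtain ⟨ξ, hξ, h⟩ := ih (derivWithin g (Set.Icc a b))
      (hg.derivWithin hu (by norm_cast)) z
      (Fin.strictMono_iff_lt_succ.2 fun i => by
        have h1 := (hzm i.castSucc).2
        have h2 := (hzm i.succ).1
        rw [Fin.succ_castSucc] at h1
        exact h1.trans h2)
      (fun i => Set.Ioo_subset_Icc_self (hzm' i))
      (fun i => by
        rw [derivWithin_of_mem_nhds (Icc_mem_nhds (hzm' i).1 (hzm' i).2), hz0])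
    exact ⟨ξ, hξ, by rw [iteratedDerivWithin_succ', h]⟩

theorem exists_iteratedDerivWithin_eq_zero_of_finset {a b : ℝ} {k : ℕ} {g : ℝ → ℝ}
    (hg : ContDiffOn ℝ k g (Set.Icc a b)) (s : Finset ℝ) (hs : s.card = k + 1)
    (hm : ∀ x ∈ s, x ∈ Set.Icc a b) (h0 : ∀ x ∈ s, g x = 0) :
    ∃ ξ ∈ Set.Icc a b, iteratedDerivWithin k g (Set.Icc a b) ξ = 0 :=
  exists_iteratedDerivWithin_eq_zero k g hg (s.orderEmbOfFin hs) (s.orderEmbOfFin hs).strictMono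
    (fun i => hm _ (s.orderEmbOfFin_mem hs i)) (fun i => h0 _ (s.orderEmbOfFin_mem hs i))

theorem iteratedDerivWithin_polynomial {a b : ℝ} (hab : a < b) (k : ℕ) :
    ∀ (p : ℝ[X]) {x : ℝ}, x ∈ Set.Icc a b →
      iteratedDerivWithin k (fun x => p.eval x) (Set.Icc a b) x = (derivative^[k] p).eval x := by
  induction k with
  | zero => intro p x _; simp
  | succ k ih =>
    intro p x hx
    rw [iteratedDerivWithin_succ', Function.iterate_succ_apply, ← ih _ hx]
    refine iteratedDerivWithin_congr (fun y hy => ?_) hx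
    exact p.derivWithin (uniqueDiffOn_Icc hab y hy)

theorem iterate_derivative_eq_C_factorial_mul_coeff {p : ℝ[X]} {k : ℕ} (h : p.natDegree ≤ k) :
    derivative^[k] p = C ((k.factorial : ℝ) * p.coeff k) := by
  ext i
  rw [coeff_iterate_derivative, coeff_C]
  split_ifs with hi
  · rw [hi, zero_add, Nat.descFactorial_self, nsmul_eq_mul]
  · rw [coeff_eq_zero_of_natDegree_lt (by omega), smul_zero]

/-- The classical error bound of Lagrange interpolation at distinct nodes. -/
theorem exists_polynomial_abs_sub_le {a b : ℝ} (hab : a < b) {k : ℕ} {f : ℝ → ℝ}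
    (hf : ContDiffOn ℝ k f (Set.Icc a b)) {M : ℝ}
    (hM : ∀ x ∈ Set.Icc a b, |iteratedDerivWithin k f (Set.Icc a b) x| ≤ M)
    (y : Fin k → ℝ) (hy : Function.Injective y) (hm : ∀ i, y i ∈ Set.Icc a b) :
    ∃ p : ℝ[X], p.degree < k ∧ ∀ x ∈ Set.Icc a b,
      |f x - p.eval x| ≤ M / k.factorial * |∏ i, (x - y i)| := by
  classical
  set p := Lagrange.interpolate Finset.univ y (fun i => f (y i)) with hp
  have hdeg : p.degree < k := by
    have := Lagrange.degree_interpolate_lt (s := Finset.univ) (v := y) (fun i => f (y i)) hy.injOn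
    rwa [Finset.card_univ, Fintype.card_fin] at this
  have hnode : ∀ i, p.eval (y i) = f (y i) := fun i =>
    Lagrange.eval_interpolate_at_node (fun i => f (y i)) hy.injOn (Finset.mem_univ i)
  refine ⟨p, hdeg, fun x hx => ?_⟩
  by_cases hxn : ∃ i, x = y i
  · obtain ⟨i, rfl⟩ := hxn
    rw [hnode, sub_self, abs_zero, Finset.prod_eq_zero (Finset.mem_univ i) (sub_self _)]
    simp
  push Not at hxn
  set ω := Lagrange.nodal Finset.univ y with hω
  have hωx : ω.eval x = ∏ i, (x - y i) := Lagrange.eval_nodal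
  have hω0 : ω.eval x ≠ 0 := by
    rw [hωx]; exact Finset.prod_ne_zero_iff.2 fun i _ => sub_ne_zero.2 (hxn i)
  -- With this `c`, $f-p-c\,\omega$ vanishes at `x` as well as at the `k` nodes, so its `k`-th
  -- derivative has a zero.
  set c := (f x - p.eval x) / ω.eval x with hc
  have hcx : f x - p.eval x = c * ω.eval x := by rw [hc, div_mul_cancel₀ _ hω0]
  set q := p + C c * ω with hq
  have hqc : ContDiffOn ℝ k (fun x => q.eval x) (Set.Icc a b) := by
    simpa using (q.contDiff_aeval (𝕜 := ℝ) (k : WithTop ℕ∞)).contDiffOn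
  obtain ⟨ξ, hξ, h⟩ := exists_iteratedDerivWithin_eq_zero_of_finset (hf.sub hqc)
    (insert x (Finset.univ.image y))
    (by
      rw [Finset.card_insert_of_notMem (by simpa [eq_comm] using hxn),
        Finset.card_image_of_injective _ hy]
      simp)
    (by
      intro t ht
      simp only [Finset.mem_insert, Finset.mem_image, Finset.mem_univ, true_and] at ht
      rcases ht with rfl | ⟨i, rfl⟩
      exacts [hx, hm i])
    (by
      intro t ht
      simp only [Finset.mem_insert, Finset.mem_image, Finset.mem_univ, true_and] at ht
      rcases ht with rfl | ⟨i, rfl⟩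
      · simp only [hq, eval_add, eval_mul, eval_C, ← hcx]; ring
      · simp [hq, hnode, hω, Lagrange.eval_nodal_at_node (Finset.mem_univ i)])
  have hu := uniqueDiffOn_Icc hab
  change iteratedDerivWithin k (f - fun x => q.eval x) _ ξ = 0 at h
  rw [iteratedDerivWithin_sub hξ hu (hf.contDiffWithinAt hξ) (hqc.contDiffWithinAt hξ),
    iteratedDerivWithin_polynomial hab k q hξ] at h
  have hωd : derivative^[k] ω = C (k.factorial : ℝ) := by
    have hmon : ω.Monic := Lagrange.nodal_monic
    have hnd : ω.natDegree = k := by simp [hω, Lagrange.natDegree_nodal]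
    have hc1 : ω.coeff k = 1 := hnd ▸ hmon.coeff_natDegree
    rw [iterate_derivative_eq_C_factorial_mul_coeff hnd.le, hc1, mul_one]
  have hqd : (derivative^[k] q).eval ξ = c * k.factorial := by
    have hpd : derivative^[k] p = 0 := by
      rcases eq_or_ne p 0 with h0 | h0
      · rw [h0, iterate_derivative_zero]
      · exact iterate_derivative_eq_zero ((natDegree_lt_iff_degree_lt h0).2 hdeg)
    rw [hq, iterate_map_add, hpd, iterate_derivative_C_mul, hωd]
    simp
  have hcb : |c| ≤ M / k.factorial := by
    have := hM ξ hξ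
    rw [sub_eq_zero.1 h, hqd, abs_mul, Nat.abs_cast] at this
    rwa [le_div_iff₀ (by positivity)]
  rw [hcx, abs_mul, hωx]
  gcongr

/-! ### From interpolation error to quadrature error. -/

theorem abs_integral_sub_sum_le_of_injective {k : ℕ} {f : ℝ → ℝ}
    (hf : ContDiffOn ℝ k f (Set.Icc (-1) 1)) {M : ℝ}
    (hM : ∀ x ∈ Set.Icc (-1 : ℝ) 1, |iteratedDerivWithin k f (Set.Icc (-1) 1) x| ≤ M)
    {s : Finset ℝ} {w : ℝ → ℝ} (hs : ∀ x ∈ s, x ∈ Set.Icc (-1 : ℝ) 1) (hw : ∀ x ∈ s, 0 ≤ w x)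
    (hex : ∀ p : ℝ[X], p.degree < k → ∫ x in (-1 : ℝ)..1, p.eval x = ∑ x ∈ s, w x * p.eval x)
    (y : Fin k → ℝ) (hy : Function.Injective y) (hm : ∀ i, y i ∈ Set.Icc (-1 : ℝ) 1) :
    |(∫ x in (-1 : ℝ)..1, f x) - ∑ x ∈ s, w x * f x| ≤ M / k.factorial *
      ((∫ x in (-1 : ℝ)..1, |∏ i, (x - y i)|) + ∑ x ∈ s, w x * |∏ i, (x - y i)|) := by
  obtain ⟨p, hp, h⟩ := exists_polynomial_abs_sub_le (by norm_num) hf hM y hy hm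
  have hfi : IntervalIntegrable f MeasureTheory.volume (-1) 1 :=
    ContinuousOn.intervalIntegrable (by rw [Set.uIcc_of_le (by norm_num)]; exact hf.continuousOn)
  have hpi : IntervalIntegrable (fun x => p.eval x) MeasureTheory.volume (-1) 1 :=
    p.continuous.intervalIntegrable _ _
  have e : (∫ x in (-1 : ℝ)..1, f x) - ∑ x ∈ s, w x * f x =
      (∫ x in (-1 : ℝ)..1, (f x - p.eval x)) - ∑ x ∈ s, w x * (f x - p.eval x) := by
    rw [intervalIntegral.integral_sub hfi hpi, hex p hp]
    simp only [mul_sub, Finset.sum_sub_distrib]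
    ring
  rw [e, mul_add, Finset.mul_sum]
  refine (abs_sub _ _).trans (add_le_add ?_ ?_)
  · rw [← intervalIntegral.integral_const_mul]
    refine (intervalIntegral.abs_integral_le_integral_abs (by norm_num)).trans
      (intervalIntegral.integral_mono_on (by norm_num) (hfi.sub hpi).abs
        (Continuous.intervalIntegrable (by fun_prop) _ _) h)
  · refine (Finset.abs_sum_le_sum_abs _ _).trans (Finset.sum_le_sum fun x hx => ?_)
    rw [abs_mul, abs_of_nonneg (hw x hx), mul_left_comm]
    exact mul_le_mul_of_nonneg_left (h x (hs x hx)) (hw x hx)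

/-- Pairs with `y i = y j` are separated by `z` for every `t > 0`; the other pairs stay apart for
small `t` by continuity. -/
theorem eventually_injective_lineMap {ι : Type*} [Finite ι] (y z : ι → ℝ)
    (hz : Function.Injective z) :
    ∀ᶠ t in nhdsWithin (0 : ℝ) (Set.Ioi 0), Function.Injective fun i => (1 - t) * y i + t * z i := by
  have h : ∀ i j, ∀ᶠ t in nhdsWithin (0 : ℝ) (Set.Ioi 0),
      (1 - t) * y i + t * z i = (1 - t) * y j + t * z j → i = j := by
    intro i j
    by_cases hy : y i = y j
    · filter_upwards [self_mem_nhdsWithin] with t ht e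
      rw [hy] at e
      exact hz (mul_left_cancel₀ (ne_of_gt ht) (add_left_cancel e))
    · have hc : ContinuousAt (fun t : ℝ => ((1 - t) * y i + t * z i) - ((1 - t) * y j + t * z j))
          0 := by fun_prop
      have := hc.eventually_ne (y := 0) (by simpa [sub_eq_zero] using hy)
      filter_upwards [nhdsWithin_le_nhds this] with t ht e
      exact absurd (sub_eq_zero.2 e) ht
  filter_upwards [Filter.eventually_all.2 fun i => Filter.eventually_all.2 (h i)] with t ht i j e
  exact ht i j e

/-- Repeated nodes are needed because the extremal `W` has double roots. The bound is continuous in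
the nodes, so moving them slightly towards distinct points and passing to the limit replaces Hermite
interpolation. -/
theorem abs_integral_sub_sum_le {k : ℕ} {f : ℝ → ℝ}
    (hf : ContDiffOn ℝ k f (Set.Icc (-1) 1)) {M : ℝ}
    (hM : ∀ x ∈ Set.Icc (-1 : ℝ) 1, |iteratedDerivWithin k f (Set.Icc (-1) 1) x| ≤ M)
    {s : Finset ℝ} {w : ℝ → ℝ} (hs : ∀ x ∈ s, x ∈ Set.Icc (-1 : ℝ) 1) (hw : ∀ x ∈ s, 0 ≤ w x)
    (hex : ∀ p : ℝ[X], p.degree < k → ∫ x in (-1 : ℝ)..1, p.eval x = ∑ x ∈ s, w x * p.eval x)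
    (y : Fin k → ℝ) (hm : ∀ i, y i ∈ Set.Icc (-1 : ℝ) 1) :
    |(∫ x in (-1 : ℝ)..1, f x) - ∑ x ∈ s, w x * f x| ≤ M / k.factorial *
      ((∫ x in (-1 : ℝ)..1, |∏ i, (x - y i)|) + ∑ x ∈ s, w x * |∏ i, (x - y i)|) := by
  set z : Fin k → ℝ := fun i => (i : ℝ) / k with hz
  have hk : ∀ i : Fin k, (0 : ℝ) < k := fun i => by exact_mod_cast i.pos
  have hzi : Function.Injective z := fun i j e => by
    have := (div_left_inj' (hk i).ne').1 e
    exact Fin.ext (by exact_mod_cast this)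
  have hzm : ∀ i, z i ∈ Set.Icc (-1 : ℝ) 1 := fun i => by
    have h1 : (i : ℝ) ≤ k := by exact_mod_cast i.2.le
    have h2 : 0 ≤ z i := by positivity
    exact ⟨by linarith, (div_le_one (hk i)).2 h1⟩
  set F : ℝ → ℝ := fun t => M / k.factorial *
      ((∫ x in (-1 : ℝ)..1, |∏ i, (x - ((1 - t) * y i + t * z i))|) +
        ∑ x ∈ s, w x * |∏ i, (x - ((1 - t) * y i + t * z i))|) with hF
  have hcont : Continuous F := by
    have : Continuous fun t : ℝ =>
        ∫ x in (-1 : ℝ)..1, |∏ i, (x - ((1 - t) * y i + t * z i))| :=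
      intervalIntegral.continuous_parametric_intervalIntegral_of_continuous' (by fun_prop) _ _
    fun_prop
  have hlim : Filter.Tendsto F (nhdsWithin 0 (Set.Ioi 0)) (nhds (F 0)) :=
    hcont.continuousAt.tendsto.mono_left nhdsWithin_le_nhds
  have hF0 : F 0 = M / k.factorial *
      ((∫ x in (-1 : ℝ)..1, |∏ i, (x - y i)|) + ∑ x ∈ s, w x * |∏ i, (x - y i)|) := by
    simp [hF]
  rw [← hF0]
  refine ge_of_tendsto hlim ?_
  filter_upwards [eventually_injective_lineMap y z hzi, Ioo_mem_nhdsGT (zero_lt_one' ℝ)]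
    with t ht ht1
  exact abs_integral_sub_sum_le_of_injective hf hM hs hw hex _ ht fun i =>
    convex_Icc (-1 : ℝ) 1 (hm i) (hzm i) (by linarith [ht1.2]) ht1.1.le (by ring)

theorem exists_fin_map_eq {α : Type*} {k : ℕ} (s : Multiset α) (hs : s.card = k) :
    ∃ y : Fin k → α, Finset.univ.val.map y = s := by
  subst hs
  obtain ⟨l, rfl⟩ := Quot.exists_rep s
  exact ⟨l.get, (Fin.univ_val_map _).trans (congrArg _ (List.ofFn_get l))⟩

/-- If a monic polynomial `W`, nonnegative on `[-1, 1]`, has degree `k` and all its roots in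
`[-1, 1]`, then a positive quadrature that is exact up to degree `k` has error at most
`2 ‖f⁽ᵏ⁾‖ / k! ∫ W`. -/
theorem abs_integral_sub_sum_le_of_splits {k : ℕ} {f : ℝ → ℝ}
    (hf : ContDiffOn ℝ k f (Set.Icc (-1) 1)) {M : ℝ}
    (hM : ∀ x ∈ Set.Icc (-1 : ℝ) 1, |iteratedDerivWithin k f (Set.Icc (-1) 1) x| ≤ M)
    {s : Finset ℝ} {w : ℝ → ℝ} (hs : ∀ x ∈ s, x ∈ Set.Icc (-1 : ℝ) 1) (hw : ∀ x ∈ s, 0 ≤ w x)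
    (hex : ∀ p : ℝ[X], p.natDegree ≤ k →
      ∫ x in (-1 : ℝ)..1, p.eval x = ∑ x ∈ s, w x * p.eval x)
    {W : ℝ[X]} (hW : W.Monic) (hWk : W.natDegree = k) (hsp : W.Splits)
    (hroot : ∀ x ∈ W.roots, x ∈ Set.Icc (-1 : ℝ) 1)
    (hpos : ∀ x ∈ Set.Icc (-1 : ℝ) 1, 0 ≤ W.eval x) :
    |(∫ x in (-1 : ℝ)..1, f x) - ∑ x ∈ s, w x * f x| ≤
      2 * (M / k.factorial) * ∫ x in (-1 : ℝ)..1, W.eval x := by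
  obtain ⟨y, hy⟩ := exists_fin_map_eq W.roots (hWk ▸ splits_iff_card_roots.1 hsp)
  have hprod : ∀ x, ∏ i, (x - y i) = W.eval x := by
    intro x
    rw [hsp.eq_prod_roots, hW.leadingCoeff, C_1, one_mul, ← hy, eval_multiset_prod]
    simp [Finset.prod, Function.comp_def]
  have h := abs_integral_sub_sum_le hf hM hs hw
    (fun p hp => hex p (natDegree_le_of_degree_le hp.le)) y
    (fun i => hroot _ (hy ▸ Multiset.mem_map_of_mem y (Finset.mem_univ i)))
  simp only [hprod] at h
  have h1 : ∫ x in (-1 : ℝ)..1, |W.eval x| = ∫ x in (-1 : ℝ)..1, W.eval x :=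
    intervalIntegral.integral_congr fun x hx => by
      rw [Set.uIcc_of_le (by norm_num)] at hx
      exact abs_of_nonneg (hpos x hx)
  have h2 : ∑ x ∈ s, w x * |W.eval x| = ∑ x ∈ s, w x * W.eval x :=
    Finset.sum_congr rfl fun x hx => by rw [abs_of_nonneg (hpos x (hs x hx))]
  -- Exactness at `W`, of degree exactly `k`, turns the quadrature sum into a second copy of the
  -- integral: hence the factor 2.
  rw [h1, h2, ← hex W hWk.le] at h
  linarith

/-! ### Integration by parts and a Beta integral. -/

/-- Integration of polynomials over `[-1, 1]`, as a linear functional. -/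
noncomputable def integralIcc : ℝ[X] →ₗ[ℝ] ℝ where
  toFun p := ∫ x in (-1 : ℝ)..1, p.eval x
  map_add' p q := by
    simp only [eval_add]
    exact intervalIntegral.integral_add (p.continuous.intervalIntegrable _ _)
      (q.continuous.intervalIntegrable _ _)
  map_smul' c p := by simp

theorem integralIcc_apply (p : ℝ[X]) : integralIcc p = ∫ x in (-1 : ℝ)..1, p.eval x := rfl

theorem integralIcc_C_mul (c : ℝ) (p : ℝ[X]) : integralIcc (C c * p) = c * integralIcc p := by
  rw [← smul_eq_C_mul, map_smul, smul_eq_mul]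

theorem integralIcc_derivative (p : ℝ[X]) :
    integralIcc (derivative p) = p.eval 1 - p.eval (-1) :=
  intervalIntegral.integral_eq_sub_of_hasDerivAt (fun x _ => p.hasDerivAt x)
    ((derivative p).continuous.intervalIntegrable _ _)

theorem integralIcc_derivative_mul (p q : ℝ[X]) :
    integralIcc (derivative p * q) =
      p.eval 1 * q.eval 1 - p.eval (-1) * q.eval (-1) - integralIcc (p * derivative q) := by
  have := integralIcc_derivative (p * q)
  rw [derivative_mul, map_add, eval_mul, eval_mul] at this
  linarith

/-- The boundary terms vanish: for `j < n`, the `j`-th derivative of `U` keeps the factors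
$(X\mp1)^{n-j}$. -/
theorem integralIcc_iterate_derivative_mul {n : ℕ} {U : ℝ[X]} (h1 : (X - 1) ^ n ∣ U)
    (h2 : (X + 1) ^ n ∣ U) (j : ℕ) (hj : j ≤ n) (q : ℝ[X]) :
    integralIcc (derivative^[j] U * q) = (-1) ^ j * integralIcc (U * derivative^[j] q) := by
  induction j generalizing q with
  | zero => simp
  | succ j ih =>
    have hr : ∀ (r : ℝ) (p : ℝ[X]), p.eval r = 0 → p ^ n ∣ U → (derivative^[j] U).eval r = 0 := by
      intro r p hp hd
      have := (dvd_pow_self p (by omega : n - j ≠ 0)).trans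
        (pow_sub_dvd_iterate_derivative_of_pow_dvd j hd)
      exact eval_eq_zero_of_dvd_of_eval_eq_zero this hp
    rw [Function.iterate_succ_apply', integralIcc_derivative_mul, hr 1 _ (by simp) h1,
      hr (-1) _ (by simp) h2, ih (by omega), ← Function.iterate_succ_apply]
    ring

/-- Integration by parts trades a power of $1-x$ for one of $1+x$, so the induction on `p` needs `q`
arbitrary. -/
theorem integralIcc_one_sub_pow_mul_one_add_pow (p q : ℕ) :
    integralIcc ((1 - X) ^ p * (1 + X) ^ q) =
      2 ^ (p + q + 1) * p.factorial * q.factorial / (p + q + 1).factorial := by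
  induction p generalizing q with
  | zero =>
    have h : (1 - X : ℝ[X]) ^ 0 * (1 + X) ^ q =
        C ((q + 1 : ℝ)⁻¹) * derivative ((1 + X) ^ (q + 1)) := by
      rw [derivative_pow, derivative_add, derivative_one, derivative_X]
      push_cast
      rw [← mul_assoc, ← mul_assoc, ← C_mul, inv_mul_cancel₀ (by positivity)]
      simp
    rw [h, integralIcc_C_mul, integralIcc_derivative]
    simp [Nat.factorial_succ]
    have : (q.factorial : ℝ) ≠ 0 := by positivity
    field_simp
    norm_num
  | succ p ih =>
    have h : (1 - X : ℝ[X]) ^ (p + 1) * (1 + X) ^ q =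
        C ((q + 1 : ℝ)⁻¹) * (derivative ((1 + X) ^ (q + 1)) * (1 - X) ^ (p + 1)) := by
      rw [derivative_pow, derivative_add, derivative_one, derivative_X]
      push_cast
      rw [← mul_assoc, ← mul_assoc, ← mul_assoc, ← C_mul, inv_mul_cancel₀ (by positivity)]
      simp [mul_comm]
    have h' : (1 + X : ℝ[X]) ^ (q + 1) * derivative ((1 - X) ^ (p + 1)) =
        C (-(p + 1 : ℝ)) * ((1 - X) ^ p * (1 + X) ^ (q + 1)) := by
      rw [derivative_pow, derivative_sub, derivative_one, derivative_X]
      simp only [zero_sub, Nat.add_sub_cancel]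
      simp
      ring
    rw [h, integralIcc_C_mul, integralIcc_derivative_mul, h', integralIcc_C_mul, ih,
      show p + 1 + q + 1 = p + (q + 1) + 1 by ring]
    simp [Nat.factorial_succ q, Nat.factorial_succ p]
    field_simp
    ring

/-! ### Location of the roots of iterated derivatives. -/

theorem splits_derivative {p : ℝ[X]} (hp : p.Splits) : (derivative p).Splits := by
  rw [splits_iff_card_roots] at hp ⊢
  refine le_antisymm (card_roots' _) ?_
  have h1 := card_roots_le_derivative p
  have h2 := natDegree_derivative_le p
  omega

/-- Outside $[a,b]$ all terms of $p'/p=\sum 1/(x-z)$ have the same strict sign. -/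
theorem roots_derivative_mem_Icc {p : ℝ[X]} (hp : p.Splits) {a b : ℝ}
    (h : ∀ x ∈ p.roots, x ∈ Set.Icc a b) : ∀ x ∈ (derivative p).roots, x ∈ Set.Icc a b := by
  intro x hx
  obtain ⟨hp', hx0⟩ := mem_roots'.1 hx
  have hp0 : p ≠ 0 := fun e => hp' (by rw [e, derivative_zero])
  have hd : p.natDegree ≠ 0 := fun e => hp' (derivative_of_natDegree_zero e)
  by_contra hxm
  have hpx : p.eval x ≠ 0 := fun e => hxm (h x (mem_roots'.2 ⟨hp0, e⟩))
  have hs := hp.eval_derivative_div_eval_of_ne_zero hpx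
  rw [hx0.eq_zero, zero_div] at hs
  have hne : p.roots ≠ ∅ := hp.roots_ne_zero hd
  have hz : (p.roots.map fun _ => (0 : ℝ)).sum = 0 := by simp
  rcases lt_or_ge x a with hxa | hxa
  · have := Multiset.sum_lt_sum_of_nonempty hne (f := fun z => 1 / (x - z)) (g := fun _ => 0)
      fun z hz => one_div_neg.2 (by linarith [(h z hz).1])
    linarith
  · have hxb : b < x := by
      by_contra hb
      exact hxm ⟨hxa, not_lt.1 hb⟩
    have := Multiset.sum_lt_sum_of_nonempty hne (f := fun _ => 0) (g := fun z => 1 / (x - z))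
      fun z hz => one_div_pos.2 (by linarith [(h z hz).2])
    linarith

theorem splits_iterate_derivative {p : ℝ[X]} (hp : p.Splits) (j : ℕ) :
    (derivative^[j] p).Splits := by
  induction j with
  | zero => exact hp
  | succ j ih => rw [Function.iterate_succ_apply']; exact splits_derivative ih

theorem roots_iterate_derivative_mem_Icc {p : ℝ[X]} (hp : p.Splits) {a b : ℝ}
    (h : ∀ x ∈ p.roots, x ∈ Set.Icc a b) (j : ℕ) :
    ∀ x ∈ (derivative^[j] p).roots, x ∈ Set.Icc a b := by
  induction j with
  | zero => exact h
  | succ j ih =>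
    rw [Function.iterate_succ_apply']
    exact roots_derivative_mem_Icc (splits_iterate_derivative hp j) ih

theorem splits_X_sub_one_pow_mul_X_add_one_pow (p q : ℕ) :
    ((X - 1) ^ p * (X + 1) ^ q : ℝ[X]).Splits := by
  have h1 : (X - 1 : ℝ[X]).Splits := by simpa using Splits.X_sub_C (1 : ℝ)
  have h2 : (X + 1 : ℝ[X]).Splits := by simpa using Splits.X_add_C (1 : ℝ)
  exact (h1.pow p).mul (h2.pow q)

theorem roots_X_sub_one_pow_mul_X_add_one_pow_mem_Icc (p q : ℕ) :
    ∀ x ∈ ((X - 1) ^ p * (X + 1) ^ q : ℝ[X]).roots, x ∈ Set.Icc (-1 : ℝ) 1 := by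
  intro x hx
  have := (mem_roots'.1 hx).2
  simp only [IsRoot.def, eval_mul, eval_pow, eval_sub, eval_add, eval_X, eval_one,
    mul_eq_zero] at this
  rcases this with h | h
  · have := eq_zero_of_pow_eq_zero h
    constructor <;> linarith
  · have := eq_zero_of_pow_eq_zero h
    constructor <;> linarith

theorem monic_X_sub_one_pow_mul_X_add_one_pow (p q : ℕ) :
    ((X - 1) ^ p * (X + 1) ^ q : ℝ[X]).Monic := by
  have h1 : (X - 1 : ℝ[X]).Monic := by simpa using monic_X_sub_C (1 : ℝ)
  have h2 : (X + 1 : ℝ[X]).Monic := by simpa using monic_X_add_C (1 : ℝ)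
  exact (h1.pow p).mul (h2.pow q)

theorem natDegree_X_sub_one_pow_mul_X_add_one_pow (p q : ℕ) :
    ((X - 1) ^ p * (X + 1) ^ q : ℝ[X]).natDegree = p + q := by
  have h1 : (X - 1 : ℝ[X]).Monic := by simpa using monic_X_sub_C (1 : ℝ)
  have h2 : (X + 1 : ℝ[X]).Monic := by simpa using monic_X_add_C (1 : ℝ)
  have d1 : (X - 1 : ℝ[X]).natDegree = 1 := by simpa using natDegree_X_sub_C (1 : ℝ)
  have d2 : (X + 1 : ℝ[X]).natDegree = 1 := by simpa using natDegree_X_add_C (1 : ℝ)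
  rw [(h1.pow p).natDegree_mul (h2.pow q), h1.natDegree_pow, h2.natDegree_pow, d1, d2, mul_one,
    mul_one]

/-! ### The extremal node polynomial and its integral. -/

/-- The extremal polynomial `(X + 1) ^ b ω ^ 2` for the Gauss (`b = 0`) and Gauss-Radau (`b = 1`)
nodes, where `ω` is the monic orthogonal polynomial of degree `n` for the weight `(1 + x) ^ b`. -/
theorem exists_extremal_polynomial (n b : ℕ) :
    ∃ W : ℝ[X], W.Monic ∧ W.natDegree = 2 * n + b ∧ W.Splits ∧
      (∀ x ∈ W.roots, x ∈ Set.Icc (-1 : ℝ) 1) ∧ (∀ x ∈ Set.Icc (-1 : ℝ) 1, 0 ≤ W.eval x) ∧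
      integralIcc W = 2 ^ (2 * n + b + 1) * (n.factorial : ℝ) ^ 2 * ((n + b).factorial : ℝ) ^ 2 /
        ((2 * n + b).factorial * (2 * n + b + 1).factorial) := by
  -- Rodrigues' formula for Jacobi polynomials: $U^{(n)}=c\,(X+1)^b\omega$.
  set U : ℝ[X] := (X - 1) ^ n * (X + 1) ^ (n + b) with hU
  have hUm : U.Monic := monic_X_sub_one_pow_mul_X_add_one_pow _ _
  have hUd : U.natDegree = 2 * n + b := by
    rw [hU, natDegree_X_sub_one_pow_mul_X_add_one_pow]; ring
  set V := derivative^[n] U with hV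
  have hVs : V.Splits := splits_iterate_derivative (splits_X_sub_one_pow_mul_X_add_one_pow _ _) n
  have hVr : ∀ x ∈ V.roots, x ∈ Set.Icc (-1 : ℝ) 1 := roots_iterate_derivative_mem_Icc
    (splits_X_sub_one_pow_mul_X_add_one_pow _ _)
    (roots_X_sub_one_pow_mul_X_add_one_pow_mem_Icc _ _) n
  have hdvd : (X + 1) ^ b ∣ V := by
    have := pow_sub_dvd_iterate_derivative_of_pow_dvd n (Dvd.intro_left _ rfl :
      (X + 1 : ℝ[X]) ^ (n + b) ∣ U)
    rwa [Nat.add_sub_cancel_left] at this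
  have h2 : (X + 1 : ℝ[X]).Monic := by simpa using monic_X_add_C (1 : ℝ)
  have d2 : (X + 1 : ℝ[X]).natDegree = 1 := by simpa using natDegree_X_add_C (1 : ℝ)
  obtain ⟨g, hg⟩ := hdvd
  set c : ℝ := (2 * n + b).factorial / (n + b).factorial with hc
  have hc0 : c ≠ 0 := by positivity
  have hVc : V.coeff (n + b) = c := by
    rw [hV, coeff_iterate_derivative, show n + b + n = 2 * n + b by ring]
    rw [← hUd, hUm.coeff_natDegree, hUd, nsmul_eq_mul, mul_one, hc, eq_div_iff (by positivity)]
    have := Nat.factorial_mul_descFactorial (n := 2 * n + b) (k := n) (by omega)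
    rw [show 2 * n + b - n = n + b by omega] at this
    rw [mul_comm]
    exact_mod_cast this
  have hVd : V.natDegree = n + b := by
    refine natDegree_eq_of_le_of_coeff_ne_zero ?_ (hVc ▸ hc0)
    exact (natDegree_iterate_derivative _ _).trans (by omega)
  have hV0 : V ≠ 0 := fun e => hc0 (by rw [← hVc, e, coeff_zero])
  have hVl : V.leadingCoeff = c := by rw [leadingCoeff, hVd, hVc]
  have hgl : g.leadingCoeff = c := by
    rw [← hVl, hg, leadingCoeff_mul, (h2.pow b).leadingCoeff, one_mul]
  have hg0 : g ≠ 0 := fun e => hV0 (by rw [hg, e, mul_zero])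
  have hgd : g.natDegree = n := by
    have := (h2.pow b).natDegree_mul' hg0
    rw [← hg, hVd, h2.natDegree_pow, d2] at this
    omega
  set ω := C c⁻¹ * g with hω
  have hωm : ω.Monic := by
    rw [Monic, hω, leadingCoeff_mul, leadingCoeff_C, hgl, inv_mul_cancel₀ hc0]
  have hωd : ω.natDegree = n := by rw [hω, natDegree_C_mul (inv_ne_zero hc0), hgd]
  have hVω : V = C c * ((X + 1) ^ b * ω) := by
    rw [hω, mul_left_comm ((X + 1) ^ b) (C c⁻¹) g, ← mul_assoc (C c), ← C_mul,
      mul_inv_cancel₀ hc0, C_1, one_mul, hg]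
  -- Through this divisibility `W` inherits splitting and the location of its roots from `V`.
  have hWdvd : (X + 1) ^ b * ω ^ 2 ∣ V ^ 2 :=
    ⟨C c ^ 2 * (X + 1) ^ b, by rw [hVω]; ring⟩
  have hV2 : V ^ 2 ≠ 0 := pow_ne_zero 2 hV0
  refine ⟨(X + 1) ^ b * ω ^ 2, (h2.pow b).mul (hωm.pow 2), ?_, (hVs.pow 2).of_dvd hV2 hWdvd,
    ?_, ?_, ?_⟩
  · rw [(h2.pow b).natDegree_mul (hωm.pow 2), h2.natDegree_pow, hωm.natDegree_pow, d2, hωd]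
    ring
  · intro x hx
    have := Multiset.mem_of_le (roots.le_of_dvd hV2 hWdvd) hx
    rw [roots_pow] at this
    exact hVr x (Multiset.mem_of_mem_nsmul this)
  · intro x hx
    have : 0 ≤ x + 1 := by linarith [hx.1]
    simp only [eval_mul, eval_pow, eval_add, eval_X, eval_one]
    positivity
  -- Since $W=c^{-1}V\omega$, integrating by parts `n` times leaves $\omega^{(n)}=n!$ against `U`, a
  -- Beta integral.
  · have e1 : (X + 1) ^ b * ω ^ 2 = C c⁻¹ * (V * ω) := by
      have hcc : C c⁻¹ * C c = 1 := by rw [← C_mul, inv_mul_cancel₀ hc0, C_1]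
      rw [hVω]
      linear_combination (-((X + 1) ^ b * ω ^ 2)) * hcc
    have e2 : derivative^[n] ω = C (n.factorial : ℝ) := by
      rw [iterate_derivative_eq_C_factorial_mul_coeff hωd.le]
      conv_lhs => rw [← hωd]
      rw [hωm.coeff_natDegree, mul_one, hωd]
    have e3 : U = C ((-1 : ℝ) ^ n) * ((1 - X) ^ n * (1 + X) ^ (n + b)) := by
      rw [hU, ← neg_sub, neg_pow, add_comm X]
      simp [mul_assoc]
    rw [e1, integralIcc_C_mul, hV, integralIcc_iterate_derivative_mul (Dvd.intro _ rfl)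
      ((pow_dvd_pow _ (Nat.le_add_right n b)).trans (Dvd.intro_left _ rfl)) n le_rfl, e2, mul_comm U,
      integralIcc_C_mul, e3, integralIcc_C_mul, integralIcc_one_sub_pow_mul_one_add_pow, hc,
      show n + (n + b) + 1 = 2 * n + b + 1 by ring]
    have hs : ((-1 : ℝ) ^ n) * (-1) ^ n = 1 := by rw [← mul_pow]; simp
    calc _ = ((-1 : ℝ) ^ n * (-1) ^ n) * (2 ^ (2 * n + b + 1) * (n.factorial : ℝ) ^ 2 *
          ((n + b).factorial : ℝ) ^ 2 / ((2 * n + b).factorial * (2 * n + b + 1).factorial)) := by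
          field_simp
      _ = _ := by rw [hs, one_mul]

/-! ### Legendre polynomials: orthogonality, differential equation, end point values. -/

theorem X_sq_sub_one_pow (m : ℕ) :
    ((X ^ 2 - 1) ^ m : ℝ[X]) = (X - 1) ^ m * (X + 1) ^ m := by
  rw [← mul_pow]; ring

theorem natDegree_legendreP_le (m : ℕ) : (legendreP m).natDegree ≤ m := by
  refine (natDegree_C_mul_le _ _).trans ((natDegree_iterate_derivative _ _).trans ?_)
  rw [X_sq_sub_one_pow, natDegree_X_sub_one_pow_mul_X_add_one_pow]
  omega

theorem coeff_legendreP (m : ℕ) :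
    (legendreP m).coeff m = (2 * m).factorial / (2 ^ m * (m.factorial : ℝ) ^ 2) := by
  have h1 : ((X ^ 2 - 1) ^ m : ℝ[X]).coeff (m + m) = 1 := by
    rw [X_sq_sub_one_pow]
    have := (monic_X_sub_one_pow_mul_X_add_one_pow m m).coeff_natDegree
    rwa [natDegree_X_sub_one_pow_mul_X_add_one_pow] at this
  have h2 : (m.factorial : ℝ) * (2 * m).descFactorial m = (2 * m).factorial := by
    have := Nat.factorial_mul_descFactorial (n := 2 * m) (k := m) (by omega)
    rw [show 2 * m - m = m by omega] at this
    exact_mod_cast this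
  rw [legendreP, coeff_C_mul, coeff_iterate_derivative, h1, ← h2, ← two_mul, nsmul_eq_mul]
  field_simp

theorem coeff_legendreP_ne_zero (m : ℕ) : (legendreP m).coeff m ≠ 0 := by
  rw [coeff_legendreP]; positivity

theorem natDegree_legendreP (m : ℕ) : (legendreP m).natDegree = m :=
  natDegree_eq_of_le_of_coeff_ne_zero (natDegree_legendreP_le m) (coeff_legendreP_ne_zero m)

theorem legendreP_ne_zero (m : ℕ) : legendreP m ≠ 0 := fun e =>
  coeff_legendreP_ne_zero m (by rw [e, coeff_zero])

theorem splits_legendreP (m : ℕ) : (legendreP m).Splits := by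
  rw [legendreP, X_sq_sub_one_pow]
  exact (Splits.C _).mul (splits_iterate_derivative (splits_X_sub_one_pow_mul_X_add_one_pow _ _) _)

theorem roots_legendreP_mem_Icc (m : ℕ) : ∀ x ∈ (legendreP m).roots, x ∈ Set.Icc (-1 : ℝ) 1 := by
  rw [legendreP, X_sq_sub_one_pow, roots_C_mul _ (by positivity)]
  exact roots_iterate_derivative_mem_Icc (splits_X_sub_one_pow_mul_X_add_one_pow _ _)
    (roots_X_sub_one_pow_mul_X_add_one_pow_mem_Icc _ _) _

/-- Orthogonality of Legendre polynomials, together with their norm. -/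
theorem integralIcc_legendreP_mul {m : ℕ} {q : ℝ[X]} (hq : q.natDegree ≤ m) :
    integralIcc (legendreP m * q) = q.coeff m / (legendreP m).coeff m * (2 / (2 * m + 1)) := by
  have e3 : ((X - 1) ^ m * (X + 1) ^ m : ℝ[X]) =
      C ((-1 : ℝ) ^ m) * ((1 - X) ^ m * (1 + X) ^ m) := by
    rw [← neg_sub, neg_pow, add_comm X]
    simp [mul_assoc]
  have hs : ((-1 : ℝ) ^ m) * (-1) ^ m = 1 := by rw [← mul_pow]; simp
  rw [coeff_legendreP, legendreP, mul_assoc, integralIcc_C_mul, X_sq_sub_one_pow,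
    integralIcc_iterate_derivative_mul (Dvd.intro _ rfl) (Dvd.intro_left _ rfl) m le_rfl,
    iterate_derivative_eq_C_factorial_mul_coeff hq, mul_comm (_ * _) (C _), integralIcc_C_mul, e3,
    integralIcc_C_mul, integralIcc_one_sub_pow_mul_one_add_pow, ← two_mul, Nat.factorial_succ]
  calc _ = ((-1 : ℝ) ^ m * (-1) ^ m) * (q.coeff m /
        ((2 * m).factorial / (2 ^ m * (m.factorial : ℝ) ^ 2)) * (2 / (2 * m + 1))) := by
        push_cast
        field_simp
        ring
    _ = _ := by rw [hs, one_mul]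

theorem integralIcc_legendreP_mul_eq_zero {m : ℕ} {q : ℝ[X]} (hq : q.natDegree < m) :
    integralIcc (legendreP m * q) = 0 := by
  rw [integralIcc_legendreP_mul hq.le, coeff_eq_zero_of_natDegree_lt hq]
  simp

/-- The Legendre differential equation. -/
theorem derivative_X_sq_sub_one_mul_derivative_legendreP (m : ℕ) :
    derivative ((X ^ 2 - 1) * derivative (legendreP m)) =
      C ((m : ℝ) * (m + 1)) * legendreP m := by
  set c : ℝ := 1 / (2 ^ m * (m.factorial : ℝ)) with hc
  set U : ℝ[X] := (X ^ 2 - 1) ^ m with hU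
  have hP : legendreP m = C c * derivative^[m] U := rfl
  have hC2 : (C 2 : ℝ[X]) = 2 := map_ofNat C 2
  have key : derivative ((X ^ 2 - 1) * derivative (derivative^[m] U)) =
      C ((m : ℝ) * (m + 1)) * derivative^[m] U := by
    cases m with
    | zero => simp [hU]
    | succ j =>
      -- The relation $(x^2-1)U'=2mxU$ with $m=j+1$; differentiating it $m+1$ times gives the
      -- equation.
      have h1 : derivative U * X * X - derivative U = C (2 * (j + 1 : ℝ)) * (U * X) := by
        rw [hU, derivative_pow]
        simp [hC2]
        ring
      have h2 := congrArg (derivative^[j + 2]) h1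
      rw [iterate_derivative_sub, iterate_derivative_C_mul, iterate_derivative_mul_X,
        iterate_derivative_mul_X, iterate_derivative_mul_X, iterate_derivative_mul_X] at h2
      simp only [Nat.add_succ_sub_one, ← Function.iterate_succ_apply, Nat.succ_eq_add_one,
        nsmul_eq_mul] at h2
      rw [derivative_mul, ← Function.iterate_succ_apply' (f := derivative),
        ← Function.iterate_succ_apply' (f := derivative)]
      simp [hC2] at h2 ⊢
      linear_combination h2
  rw [hP, derivative_C_mul, mul_left_comm, derivative_C_mul, key]
  ring

/-- Integrating $P'P$ and $P'\cdot xP$ by parts gives $P(1)^2-P(-1)^2=0$ and $P(1)^2+P(-1)^2=2$.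
Only squares are needed, as the weights contain $P^2$. -/
theorem eval_one_sq_and_eval_neg_one_sq_legendreP {m : ℕ} (hm : 1 ≤ m) :
    (legendreP m).eval 1 ^ 2 = 1 ∧ (legendreP m).eval (-1) ^ 2 = 1 := by
  set P := legendreP m with hP
  have hd : P.natDegree ≤ m := natDegree_legendreP_le m
  have hd' : (derivative P).natDegree < m := by
    have := natDegree_derivative_le P
    omega
  have ha : P.coeff m ≠ 0 := coeff_legendreP_ne_zero m
  have h1 := integralIcc_derivative_mul P P
  rw [mul_comm (derivative P), integralIcc_legendreP_mul_eq_zero hd'] at h1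
  have h2 := integralIcc_derivative_mul P (X * P)
  have e1 : derivative P * (X * P) = P * (X * derivative P) := by ring
  have e2 : P * derivative (X * P) = P * P + P * (X * derivative P) := by
    rw [derivative_mul, derivative_X]; ring
  have h3 : integralIcc (P * P) = 2 / (2 * m + 1) := by
    rw [integralIcc_legendreP_mul hd, div_self ha, one_mul]
  have hc : (X * derivative P).coeff m = m * P.coeff m := by
    obtain ⟨j, rfl⟩ := Nat.exists_eq_add_of_le' hm
    rw [coeff_X_mul, coeff_derivative]
    push_cast
    ring
  have h4 : integralIcc (P * (X * derivative P)) = m * (2 / (2 * m + 1)) := by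
    rw [integralIcc_legendreP_mul (natDegree_mul_le.trans (by rw [natDegree_X]; omega)), hc,
      mul_div_cancel_right₀ _ ha]
  rw [e1, e2, map_add, h3, h4] at h2
  simp only [eval_mul, eval_X] at h2
  have h5 : (2 * m + 1 : ℝ) * (2 / (2 * m + 1)) = 2 := by field_simp
  constructor <;> nlinarith

/-! ### Lobatto nodes, weights and exactness. -/

/-- The node polynomial `(X ^ 2 - 1) P_m'` of the `(m + 1)`-point Lobatto quadrature. -/
noncomputable def lobattoNodePoly (m : ℕ) : ℝ[X] := (X ^ 2 - 1) * derivative (legendreP m)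

theorem derivative_lobattoNodePoly (m : ℕ) :
    derivative (lobattoNodePoly m) = C ((m : ℝ) * (m + 1)) * legendreP m :=
  derivative_X_sq_sub_one_mul_derivative_legendreP m

theorem X_sq_sub_one_eq : (X ^ 2 - 1 : ℝ[X]) = (X - 1) ^ 1 * (X + 1) ^ 1 := by ring

theorem monic_X_sq_sub_one : (X ^ 2 - 1 : ℝ[X]).Monic := by
  rw [X_sq_sub_one_eq]; exact monic_X_sub_one_pow_mul_X_add_one_pow 1 1

theorem natDegree_X_sq_sub_one : (X ^ 2 - 1 : ℝ[X]).natDegree = 2 := by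
  rw [X_sq_sub_one_eq, natDegree_X_sub_one_pow_mul_X_add_one_pow]

theorem derivative_legendreP_ne_zero {m : ℕ} (hm : 1 ≤ m) : derivative (legendreP m) ≠ 0 := by
  intro e
  have := congrArg (fun p => p.coeff (m - 1)) e
  simp only [coeff_derivative, coeff_zero] at this
  rw [Nat.sub_add_cancel hm, mul_eq_zero] at this
  exact this.elim (coeff_legendreP_ne_zero m) (by positivity)

theorem lobattoNodePoly_ne_zero {m : ℕ} (hm : 1 ≤ m) : lobattoNodePoly m ≠ 0 :=
  mul_ne_zero monic_X_sq_sub_one.ne_zero (derivative_legendreP_ne_zero hm)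

theorem coeff_lobattoNodePoly (m : ℕ) :
    (lobattoNodePoly m).coeff (m + 1) = m * (legendreP m).coeff m := by
  have h := coeff_derivative (lobattoNodePoly m) m
  rw [derivative_lobattoNodePoly, coeff_C_mul] at h
  have : (m + 1 : ℝ) ≠ 0 := by positivity
  apply mul_right_cancel₀ this
  linear_combination -h

theorem natDegree_lobattoNodePoly {m : ℕ} (hm : 1 ≤ m) : (lobattoNodePoly m).natDegree = m + 1 := by
  refine natDegree_eq_of_le_of_coeff_ne_zero (natDegree_mul_le.trans ?_) ?_
  · have := natDegree_derivative_le (legendreP m)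
    rw [natDegree_legendreP] at this
    rw [natDegree_X_sq_sub_one]
    omega
  · rw [coeff_lobattoNodePoly]
    exact mul_ne_zero (by positivity) (coeff_legendreP_ne_zero m)

theorem leadingCoeff_lobattoNodePoly {m : ℕ} (hm : 1 ≤ m) :
    (lobattoNodePoly m).leadingCoeff = m * (legendreP m).coeff m := by
  rw [leadingCoeff, natDegree_lobattoNodePoly hm, coeff_lobattoNodePoly]

theorem splits_lobattoNodePoly (m : ℕ) : (lobattoNodePoly m).Splits := by
  rw [lobattoNodePoly, X_sq_sub_one_eq]
  exact (splits_X_sub_one_pow_mul_X_add_one_pow 1 1).mul (splits_derivative (splits_legendreP m))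

theorem roots_lobattoNodePoly_mem_Icc {m : ℕ} (hm : 1 ≤ m) :
    ∀ x ∈ (lobattoNodePoly m).roots, x ∈ Set.Icc (-1 : ℝ) 1 := by
  intro x hx
  rw [lobattoNodePoly, X_sq_sub_one_eq, roots_mul (by
    rw [← X_sq_sub_one_eq]; exact lobattoNodePoly_ne_zero hm), Multiset.mem_add] at hx
  exact hx.elim (roots_X_sub_one_pow_mul_X_add_one_pow_mem_Icc 1 1 x)
    (roots_derivative_mem_Icc (splits_legendreP m) (roots_legendreP_mem_Icc m) x)

/-- Let $Q$ be the node polynomial. At a common zero of $P$ and $Q$ other than $\pm1$, $Q$ has the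
multiplicity of $P'$, one less than that of $P$; but $Q'$ is a nonzero multiple of $P$, so $P$ has
multiplicity one less than $Q$, a contradiction. -/
theorem eval_legendreP_ne_zero {m : ℕ} (hm : 1 ≤ m) {x : ℝ} (hx : (lobattoNodePoly m).eval x = 0) :
    (legendreP m).eval x ≠ 0 := by
  intro hP
  have hend := eval_one_sq_and_eval_neg_one_sq_legendreP hm
  have hx2 : (X ^ 2 - 1 : ℝ[X]).eval x ≠ 0 := by
    intro h
    have h' : (x - 1) * (x + 1) = 0 := by simp at h; linear_combination h
    rcases mul_eq_zero.1 h' with h | h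
    · rw [sub_eq_zero.1 h] at hP; rw [hP] at hend; norm_num at hend
    · rw [eq_neg_of_add_eq_zero_left h] at hP; rw [hP] at hend; norm_num at hend
  have hP' : (derivative (legendreP m)).eval x = 0 := by
    rw [lobattoNodePoly, eval_mul] at hx
    exact (mul_eq_zero.1 hx).resolve_left hx2
  have h1 := derivative_rootMultiplicity_of_root (p := legendreP m) (t := x) hP
  have h2 := derivative_rootMultiplicity_of_root (p := lobattoNodePoly m) (t := x) hx
  have h3 : (lobattoNodePoly m).rootMultiplicity x =
      (derivative (legendreP m)).rootMultiplicity x := by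
    rw [lobattoNodePoly, rootMultiplicity_mul (lobattoNodePoly_ne_zero hm),
      rootMultiplicity_eq_zero hx2, zero_add]
  have hm0 : (m : ℝ) * (m + 1) ≠ 0 := by positivity
  have h4 : (derivative (lobattoNodePoly m)).rootMultiplicity x =
      (legendreP m).rootMultiplicity x := by
    rw [derivative_lobattoNodePoly, rootMultiplicity_mul
      (mul_ne_zero (C_ne_zero.2 hm0) (legendreP_ne_zero m)), rootMultiplicity_C, zero_add]
  have h5 := (rootMultiplicity_pos (derivative_legendreP_ne_zero hm)).2 hP'
  omega

theorem nodup_roots_lobattoNodePoly {m : ℕ} (hm : 1 ≤ m) : (lobattoNodePoly m).roots.Nodup := by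
  classical
  refine Multiset.nodup_iff_count_le_one.2 fun x => ?_
  rw [count_roots]
  by_contra h
  obtain ⟨h1, h2⟩ := (one_lt_rootMultiplicity_iff_isRoot (lobattoNodePoly_ne_zero hm)).1
    (not_le.1 h)
  rw [derivative_lobattoNodePoly, IsRoot.def, eval_mul, eval_C] at h2
  have hm0 : (m : ℝ) * (m + 1) ≠ 0 := by positivity
  exact eval_legendreP_ne_zero hm h1 ((mul_eq_zero.1 h2).resolve_left hm0)

/-- The nodes of the `(m + 1)`-point Lobatto quadrature, end points included. -/
noncomputable def lobattoNodes (m : ℕ) : Finset ℝ := (lobattoNodePoly m).roots.toFinset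

theorem mem_lobattoNodes {m : ℕ} (hm : 1 ≤ m) {x : ℝ} :
    x ∈ lobattoNodes m ↔ (lobattoNodePoly m).eval x = 0 := by
  rw [lobattoNodes, Multiset.mem_toFinset, mem_roots (lobattoNodePoly_ne_zero hm), IsRoot.def]

theorem card_lobattoNodes {m : ℕ} (hm : 1 ≤ m) : (lobattoNodes m).card = m + 1 := by
  rw [lobattoNodes, Multiset.toFinset_card_of_nodup (nodup_roots_lobattoNodePoly hm),
    splits_iff_card_roots.1 (splits_lobattoNodePoly m), natDegree_lobattoNodePoly hm]

theorem lobattoNodePoly_eq_C_mul_nodal {m : ℕ} (hm : 1 ≤ m) :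
    lobattoNodePoly m = C (m * (legendreP m).coeff m) * Lagrange.nodal (lobattoNodes m) id := by
  conv_lhs => rw [(splits_lobattoNodePoly m).eq_prod_roots, leadingCoeff_lobattoNodePoly hm]
  rw [Lagrange.nodal, lobattoNodes, Finset.prod, Multiset.toFinset_val,
    (nodup_roots_lobattoNodePoly hm).dedup]
  rfl

/-- As $X^2-1$ vanishes at both ends, one integration by parts reduces to $-\int P\,((X^2-1)q)'$,
where orthogonality sees only the top coefficient. Degree below $m-1$ serves exactness; degree $m-1$
serves the weights. -/
theorem integralIcc_lobattoNodePoly_mul {m : ℕ} (hm : 1 ≤ m) {q : ℝ[X]}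
    (hq : q.natDegree ≤ m - 1) :
    integralIcc (lobattoNodePoly m * q) =
      -(q.coeff (m - 1) * (m + 1) / (legendreP m).coeff m * (2 / (2 * m + 1))) := by
  have h := integralIcc_derivative_mul (legendreP m) ((X ^ 2 - 1) * q)
  have hd : ((X ^ 2 - 1) * q).natDegree ≤ m + 1 := by
    refine natDegree_mul_le.trans ?_
    rw [natDegree_X_sq_sub_one]
    omega
  have hc : ((X ^ 2 - 1) * q).coeff (m + 1) = q.coeff (m - 1) := by
    have := coeff_mul_add_eq_of_natDegree_le natDegree_X_sq_sub_one.le hq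
    rw [show 2 + (m - 1) = m + 1 by omega] at this
    have h2 := monic_X_sq_sub_one.coeff_natDegree
    rw [natDegree_X_sq_sub_one] at h2
    rw [this, h2, one_mul]
  have hd' : (derivative ((X ^ 2 - 1) * q)).natDegree ≤ m :=
    (natDegree_derivative_le _).trans (by omega)
  rw [integralIcc_legendreP_mul hd', coeff_derivative, hc] at h
  have e : lobattoNodePoly m * q = derivative (legendreP m) * ((X ^ 2 - 1) * q) := by
    rw [lobattoNodePoly]; ring
  rw [e, h]
  simp

theorem integralIcc_basis_lobattoNodes {m : ℕ} (hm : 1 ≤ m) {x : ℝ} (hx : x ∈ lobattoNodes m) :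
    integralIcc (Lagrange.basis (lobattoNodes m) id x) =
      2 / (m * (m + 1) * (legendreP m).eval x ^ 2) := by
  classical
  set P := legendreP m with hP
  set S := lobattoNodes m with hS
  set a := P.coeff m with ha
  have ha0 : a ≠ 0 := coeff_legendreP_ne_zero m
  have hm0 : (m : ℝ) ≠ 0 := by positivity
  have hPx : P.eval x ≠ 0 := eval_legendreP_ne_zero hm ((mem_lobattoNodes hm).1 hx)
  set T : ℝ[X] := Lagrange.nodal (S.erase x) id with hT
  have hTm : T.Monic := Lagrange.nodal_monic
  have hTd : T.natDegree = m := by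
    rw [hT, Lagrange.natDegree_nodal, Finset.card_erase_of_mem hx, card_lobattoNodes hm,
      Nat.add_sub_cancel]
  have hQ : lobattoNodePoly m = C (m * a) * ((X - C x) * T) := by
    rw [lobattoNodePoly_eq_C_mul_nodal hm, Lagrange.nodal_eq_mul_nodal_erase hx, id]
  have hTx : m * a * T.eval x = m * (m + 1) * P.eval x := by
    have h1 := congrArg (eval x) (derivative_lobattoNodePoly m)
    rw [hQ] at h1
    simpa using h1
  have hTx0 : T.eval x ≠ 0 := fun e => by
    rw [e, mul_zero] at hTx
    exact mul_ne_zero (by positivity) hPx hTx.symm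
  have hbasis : Lagrange.basis S id x = C ((T.eval x)⁻¹) * T := by
    rw [Lagrange.basis_eq_prod_sub_inv_mul_nodal_div hx, Lagrange.nodalWeight_eq_eval_nodal_erase_inv,
      ← Lagrange.nodal_erase_eq_nodal_div hx, id]
  -- With $G=(P-P(x))/(X-x)$, the product of the node polynomial and $G$ is $ma\,(PT-P(x)T)$. The
  -- integrals of this product and of $PT$ are known, which determines $\int T$.
  obtain ⟨G, hG⟩ : X - C x ∣ P - C (P.eval x) := X_sub_C_dvd_sub_C_eval
  have hGd : G.natDegree + 1 = m := by
    have h := congrArg natDegree hG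
    rw [natDegree_sub_C, natDegree_legendreP] at h
    have hG0 : G ≠ 0 := fun e => by
      rw [e, mul_zero, natDegree_zero] at h
      omega
    rw [(monic_X_sub_C x).natDegree_mul' hG0, natDegree_X_sub_C] at h
    omega
  have hGc : G.coeff (m - 1) = a := by
    have h := congrArg (fun p => p.coeff m) hG
    have hl := coeff_mul_add_eq_of_natDegree_le (natDegree_X_sub_C x).le
      (le_refl G.natDegree)
    rw [add_comm, hGd, coeff_sub, coeff_X_one, coeff_C_of_ne_zero one_ne_zero, sub_zero, one_mul] at hl
    simp only [coeff_sub, coeff_C_of_ne_zero (by omega : m ≠ 0), sub_zero, hl] at h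
    rw [ha, h, ← hGd, Nat.add_sub_cancel]
  have i1 : integralIcc (P * T) = 1 / a * (2 / (2 * m + 1)) := by
    rw [integralIcc_legendreP_mul hTd.le]
    conv_lhs => rw [← hTd]
    rw [hTm.coeff_natDegree, hTd]
  have i2 : integralIcc (lobattoNodePoly m * G) = -(a * (m + 1) / a * (2 / (2 * m + 1))) := by
    rw [integralIcc_lobattoNodePoly_mul hm (by omega), hGc]
  have e : lobattoNodePoly m * G = C (m * a) * (P * T) - C (m * a * P.eval x) * T := by
    rw [hQ, C_mul (a := (m : ℝ) * a)]
    linear_combination (-C ((m : ℝ) * a) * T) * hG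
  rw [e, map_sub, integralIcc_C_mul, integralIcc_C_mul, i1] at i2
  rw [hbasis, integralIcc_C_mul]
  have i3 : m * a * P.eval x * integralIcc T = 2 := by
    have h1 : m * a * (1 / a * (2 / (2 * m + 1) : ℝ)) = m * (2 / (2 * m + 1)) := by field_simp
    have h2 : a * (m + 1) / a * (2 / (2 * m + 1) : ℝ) = (m + 1) * (2 / (2 * m + 1)) := by
      field_simp
    have h3 : (2 * m + 1 : ℝ) * (2 / (2 * m + 1)) = 2 := by field_simp
    rw [h1, h2] at i2
    linarith
  have e3 : integralIcc T = 2 / (m * a * P.eval x) := by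
    rw [eq_div_iff (by positivity)]
    linarith
  have e4 : T.eval x = m * (m + 1) * P.eval x / (m * a) := by
    rw [eq_div_iff (by positivity)]
    linarith
  rw [e3, e4]
  field_simp

/-- The Lobatto quadrature with `m + 1` nodes is exact up to degree `2 m - 1`. -/
theorem integral_eq_sum_lobattoNodes {m : ℕ} (hm : 2 ≤ m) {p : ℝ[X]}
    (hp : p.natDegree ≤ 2 * m - 1) :
    ∫ x in (-1 : ℝ)..1, p.eval x =
      ∑ x ∈ lobattoNodes m, 2 / (m * (m + 1) * (legendreP m).eval x ^ 2) * p.eval x := by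
  classical
  have hm1 : 1 ≤ m := by omega
  rw [← integralIcc_apply]
  set S := lobattoNodes m with hS
  set N : ℝ[X] := Lagrange.nodal S id with hN
  have hNm : N.Monic := Lagrange.nodal_monic
  have hNd : N.degree = S.card := Lagrange.degree_nodal
  -- The remainder is its own interpolant at the nodes; the multiple of `N` integrates to zero by
  -- orthogonality.
  set r := p %ₘ N with hr
  have hpr : r + N * (p /ₘ N) = p := modByMonic_add_div p N
  have hNI : integralIcc (N * (p /ₘ N)) = 0 := by
    -- The quotient has degree at most $(2m-1)-(m+1)=m-2$; in `ℕ` this is strictly below $m-1$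
    -- because $m\ge2$.
    have hq : (p /ₘ N).natDegree < m - 1 := by
      rw [natDegree_divByMonic p hNm, hN, Lagrange.natDegree_nodal, card_lobattoNodes hm1]
      omega
    have hl : (m : ℝ) * (legendreP m).coeff m ≠ 0 :=
      mul_ne_zero (by positivity) (coeff_legendreP_ne_zero m)
    have := integralIcc_lobattoNodePoly_mul hm1 hq.le
    rw [coeff_eq_zero_of_natDegree_lt hq, lobattoNodePoly_eq_C_mul_nodal hm1, mul_assoc,
      integralIcc_C_mul] at this
    simpa [hl] using this
  have hrx : ∀ x ∈ S, r.eval x = p.eval x := fun x hx => by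
    conv_rhs => rw [← hpr]
    have : N.eval x = 0 := Lagrange.eval_nodal_at_node (v := id) hx
    rw [eval_add, eval_mul, this, zero_mul, add_zero]
  have hri : r = ∑ x ∈ S, C (p.eval x) * Lagrange.basis S id x := by
    rw [Lagrange.eq_interpolate_of_eval_eq (v := id) (fun x => p.eval x) Function.injective_id.injOn
      (hNd ▸ degree_modByMonic_lt p hNm) hrx, Lagrange.interpolate_apply]
  conv_lhs => rw [← hpr]
  rw [map_add, hNI, add_zero, hri, map_sum]
  refine Finset.sum_congr rfl fun x hx => ?_
  rw [integralIcc_C_mul, integralIcc_basis_lobattoNodes hm1 hx, mul_comm]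

/-- Since $P_m(\pm1)^2=1$, the end point weights obey the interior formula. -/
theorem lobatto_eq_sum_lobattoNodes {m : ℕ} (hm : 1 ≤ m) (f : ℝ → ℝ) :
    lobatto (m + 1) f =
      ∑ x ∈ lobattoNodes m, 2 / (m * (m + 1) * (legendreP m).eval x ^ 2) * f x := by
  classical
  have hend := eval_one_sq_and_eval_neg_one_sq_legendreP hm
  have hm0 : (m : ℝ) * (m + 1) ≠ 0 := by positivity
  -- At $x=\pm1$ the Legendre equation reads $2xP'(x)=m(m+1)P(x)$, so the end points are not counted
  -- again among the interior nodes.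
  have hder : ∀ x, (legendreP m).eval x ^ 2 = 1 → x ^ 2 = 1 →
      (derivative (legendreP m)).eval x ≠ 0 := by
    intro x hx hx2 h
    have h1 := congrArg (eval x) (derivative_X_sq_sub_one_mul_derivative_legendreP m)
    simp only [derivative_mul, eval_add, eval_mul, eval_sub, eval_pow, eval_X, eval_one, hx2, h,
      eval_C] at h1
    have : (legendreP m).eval x = 0 := by
      simpa [hm0] using h1.symm
    rw [this] at hx
    norm_num at hx
  have hS : lobattoNodes m =
      insert (-1) (insert 1 (derivative (legendreP m)).roots.toFinset) := by
    ext x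
    rw [mem_lobattoNodes hm, lobattoNodePoly, eval_mul, mul_eq_zero, Finset.mem_insert,
      Finset.mem_insert, Multiset.mem_toFinset, mem_roots (derivative_legendreP_ne_zero hm),
      IsRoot.def, ← or_assoc]
    refine or_congr_left ?_
    rw [eval_sub, eval_pow, eval_X, eval_one, sub_eq_zero, sq_eq_one_iff, or_comm]
  have h1 : (1 : ℝ) ∉ (derivative (legendreP m)).roots.toFinset := fun h =>
    hder 1 hend.1 (by norm_num) (mem_roots'.1 (Multiset.mem_toFinset.1 h)).2
  have h2 : (-1 : ℝ) ∉ insert 1 (derivative (legendreP m)).roots.toFinset := fun h => by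
    rcases Finset.mem_insert.1 h with h | h
    · norm_num at h
    · exact hder (-1) hend.2 (by norm_num) (mem_roots'.1 (Multiset.mem_toFinset.1 h)).2
  rw [hS, Finset.sum_insert h2, Finset.sum_insert h1, hend.1, hend.2, lobatto]
  simp only [lobattoWeight, Nat.add_sub_cancel]
  push_cast
  rw [add_sub_cancel_right, mul_comm (m + 1 : ℝ) m, mul_one, add_assoc]

/-! ### The constant and the final bound. -/

theorem abs_iteratedDerivWithin_le_supNormIcc {k : ℕ} {f : ℝ → ℝ}
    (hf : ContDiffOn ℝ k f (Set.Icc (-1 : ℝ) 1)) :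
    ∀ x ∈ Set.Icc (-1 : ℝ) 1, |iteratedDerivWithin k f (Set.Icc (-1) 1) x| ≤
      supNormIcc (fun x => iteratedDerivWithin k f (Set.Icc (-1 : ℝ) 1) x) := by
  intro x hx
  have hc := hf.continuousOn_iteratedDerivWithin le_rfl (uniqueDiffOn_Icc (by norm_num))
  exact le_csSup (isCompact_Icc.image_of_continuousOn hc.abs).bddAbove (Set.mem_image_of_mem _ hx)

theorem alphaConst_two_mul_add (n b : ℕ) (hb : b < 2) :
    alphaConst (2 * n + b) = 2 / (2 * n + b).factorial *
      (2 ^ (2 * n + b + 1) * (n.factorial : ℝ) ^ 2 * ((n + b).factorial : ℝ) ^ 2 /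
        ((2 * n + b).factorial * (2 * n + b + 1).factorial)) := by
  have h4 : (4 : ℝ) ^ n = 2 ^ (2 * n) := by rw [pow_mul]; norm_num
  have hd : (2 * n + b) / 2 = n := by omega
  interval_cases b
  · rw [alphaConst, if_pos (by simp), hd, Nat.factorial_succ (2 * n + 0), pow_succ, h4]
    push_cast
    simp only [add_zero]
    field_simp
    ring
  · rw [alphaConst, if_neg (by simp), hd, Nat.factorial_succ (2 * n + 1),
      Nat.factorial_succ n, pow_succ, h4]
    push_cast
    field_simp
    ring

theorem mainTheorem8 (k N : ℕ) (hk : 2 ≤ k) (hN : k / 2 + 1 < N)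
    (f : ℝ → ℝ) (hf : ContDiffOn ℝ k f (Set.Icc (-1 : ℝ) 1)) :
    |(∫ x in (-1 : ℝ)..1, f x) - lobatto N f|
      ≤ alphaConst k *
        supNormIcc (fun x => iteratedDerivWithin k f (Set.Icc (-1 : ℝ) 1) x) := by
  obtain ⟨m, rfl⟩ : ∃ m, N = m + 1 := ⟨N - 1, by omega⟩
  obtain ⟨n, b, hb, rfl⟩ : ∃ n b, b < 2 ∧ k = 2 * n + b :=
    ⟨k / 2, k % 2, Nat.mod_lt _ (by norm_num), (Nat.div_add_mod k 2).symm⟩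
  have hm : 2 ≤ m := by omega
  obtain ⟨W, hWm, hWd, hWs, hWr, hWp, hWI⟩ := exists_extremal_polynomial n b
  rw [lobatto_eq_sum_lobattoNodes (by omega)]
  refine (abs_integral_sub_sum_le_of_splits hf (abs_iteratedDerivWithin_le_supNormIcc hf)
    (fun x hx => roots_lobattoNodePoly_mem_Icc (by omega) x (Multiset.mem_toFinset.1 hx))
    (fun x _ => by positivity)
    -- The hypothesis on `N` gives $m\ge n+1$, hence $k=2n+b\le2n+1\le2m-1$.
    (fun p hp => integral_eq_sum_lobattoNodes hm (by omega)) hWm hWd hWs hWr hWp).trans_eq ?_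
  rw [← integralIcc_apply, hWI, alphaConst_two_mul_add n b hb]
  ring
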